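/- Let $0<a<b$ with $a+b<1$. The Moran set $C_{ab}\subset[0,1]$ is obtained from $[0,1]$ (the Moran interval of step $0$) by replacing, at each step, every Moran interval $I$ by its left child (the leftmost closed subinterval of $I$, of length $a|I|$) and its right child (the rightmost closed subinterval of $I$, of length $b|I|$), and intersecting over all steps. Fix $0<p<1/2$ and let $p_1,p_2,\dots$ be independent random variables on a probability space $(\Omega,\mathcal P)$, each uniformly distributed on the two-point set $\{p,1-p\}$. For $\omega\in\Omega$ let $\mu_\omega$ be the Borel probability measure on $C_{ab}$ such that, for every $n\ge 0$ and every Moran interval $I$ of step $n$, the left child of $I$ has measure $p_{n+1}(\omega)\mu_\omega(I)$ and the right child has measure $(1-p_{n+1}(\omega))\mu_\omega(I)$. A dimension function is a map $\Phi:(0,1)\to[0,\infty)$ such that $t^{1+\Phi(t)}$ decreases to $0$ as $t$ decreases to $0$. It is called large if $\Phi(t)=H(t)\,\dfrac{\log|\log t|}{|\log t|}$ for all $t$ near $0$, where $H(t)\to\infty$ as $t\to0^+$. The upper $\Phi$-dimension $\overline{\dim}_\Phi\mu$ of a measure $\mu$ is the infimum of the $d\in\mathbb R$ for which there are $C_1,C_2>0$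 such that $$\frac{\mu(B(x,R))}{\mu(B(x,r))}\le C_2\Big(\frac Rr\Big)^d\qquad\text{for all } 0<r<R^{1+\Phi(R)}\le R\le C_1\ (R<1)\text{ and all } x\in\operatorname{supp}\mu ,$$ where $B(x,R)$ is the open ball of radius $R$ centred at $x$. Define real numbers $\beta$ and $\eta$ by $a^\beta=b$ and $(1-p)^\eta=p$. Then there is a set $\Gamma\subseteq\Omega$ of full measure such that, for every $\omega\in\Gamma$ and every large dimension function $\Phi$, $$\overline{\dim}_\Phi\mu_\omega=\begin{cases}\dfrac{\log p+\log(1-p)}{2\log b} & \text{if } \eta+1+\beta-3\eta\beta\ge 0,\\[2ex] \dfrac{\log p}{\frac12(\log a+\log b)} & \text{if } \eta+1+\beta-3\eta\beta<0.\end{cases}$$ -/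

import Mathlib

open MeasureTheory ProbabilityTheory Filter Topology unitInterval

noncomputable section

/-! ### Dimension functions and the upper dimension of a measure -/

/-- A dimension function is a map from `(0,1)` to the non-negative reals such that `t ^ (1 + Φ t)`
decreases to `0` as `t` decreases to `0`. Only the values of `Φ` on `(0,1)` are relevant. -/
structure IsDimensionFunction (Φ : ℝ → ℝ) : Prop where
  nonneg : ∀ t ∈ Set.Ioo (0 : ℝ) 1, 0 ≤ Φ t
  monotoneOn : MonotoneOn (fun t : ℝ => t ^ (1 + Φ t)) (Set.Ioo (0 : ℝ) 1)
  tendsto_zero : Tendsto (fun t : ℝ => t ^ (1 + Φ t)) (𝓝[>] 0) (𝓝 0)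

/-- `Φ` is large if `Φ t = H t * log |log t| / |log t|` for `t` near `0`, where `H t → ∞` as
`t → 0`. -/
def IsLargeDimensionFunction (Φ : ℝ → ℝ) : Prop :=
  ∃ H : ℝ → ℝ, Tendsto H (𝓝[>] 0) atTop ∧
    ∀ᶠ t in 𝓝[>] (0 : ℝ), Φ t = H t * (Real.log |Real.log t| / |Real.log t|)

/-- `d` is an admissible exponent: there are `C₁, C₂ > 0` such that, for all
`0 < r < R ^ (1 + Φ R) ≤ R ≤ C₁` (with `R` in the domain `(0,1)` of `Φ`) and all `x` in the support
of `μ`, `μ (B(x,R)) / μ (B(x,r)) ≤ C₂ (R / r) ^ d`. -/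
def IsUpperPhiExponent {X : Type*} [PseudoMetricSpace X] [MeasurableSpace X]
    (Φ : ℝ → ℝ) (μ : Measure X) (d : ℝ) : Prop :=
  ∃ C₁ > (0 : ℝ), ∃ C₂ > (0 : ℝ), ∀ r R : ℝ, R ∈ Set.Ioo (0 : ℝ) 1 →
    0 < r → r < R ^ (1 + Φ R) → R ^ (1 + Φ R) ≤ R → R ≤ C₁ →
    ∀ x ∈ μ.support,
      μ (Metric.ball x R) / μ (Metric.ball x r) ≤ ENNReal.ofReal (C₂ * (R / r) ^ d)

/-- The upper `Φ`-dimension of a measure: the infimum, in the extended reals, of the admissible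
exponents. -/
def upperPhiDim {X : Type*} [PseudoMetricSpace X] [MeasurableSpace X]
    (Φ : ℝ → ℝ) (μ : Measure X) : EReal :=
  sInf ((fun d : ℝ => (d : EReal)) '' {d : ℝ | IsUpperPhiExponent Φ μ d})

/-! ### The Moran set `C_{ab}`

Children are labelled by `false` (left) and `true` (right). A Moran interval of step `n` is
described by an infinite word `v`, of which only the first `n` letters matter. -/

/-- Length of the Moran interval of step `n` along `v`. -/
def moranLength (a b : ℝ) (v : ℕ → Bool) : ℕ → ℝ
  | 0 => 1
  | n + 1 => (if v n then b else a) * moranLength a b v n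

/-- Left end point of the Moran interval of step `n` along `v`: a left child shares the left end
point of its parent, a right child shares the right end point. -/
def moranLeft (a b : ℝ) (v : ℕ → Bool) : ℕ → ℝ
  | 0 => 0
  | n + 1 => moranLeft a b v n + (if v n then (1 - b) * moranLength a b v n else 0)

/-- The Moran interval of step `n` along `v`. -/
def moranInterval (a b : ℝ) (v : ℕ → Bool) (n : ℕ) : Set ℝ :=
  Set.Icc (moranLeft a b v n) (moranLeft a b v n + moranLength a b v n)

/-- The Moran set `C_{ab}`. -/
def moranSet (a b : ℝ) : Set ℝ :=
  ⋂ n : ℕ, ⋃ v : ℕ → Bool, moranInterval a b v n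

/-- The point of `C_{ab}` with address `v`: the limit of the (non-decreasing) left end points of the
Moran intervals along `v`. -/
def moranPoint (a b : ℝ) (v : ℕ → Bool) : ℝ :=
  ⨆ n : ℕ, moranLeft a b v n

/-- The Moran measure on `C_{ab}` with probabilities `p 0, p 1, …`: at step `n + 1` each Moran
interval of step `n` gives the fraction `p n` of its mass to its left child and the fraction
`1 - p n` to its right child. It is the image under the address map of the product of the measures
`p n • δ_false + (1 - p n) • δ_true`; see `moranMeasure_moranInterval_succ` for the mass rule. -/
def moranMeasure (a b : ℝ) (p : ℕ → I) : Measure ℝ :=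
  (Measure.infinitePi fun n => bernoulliMeasure false true (p n)).map (moranPoint a b)

/-! ### The Moran measure is a probability measure on `C_{ab}` and obeys the mass rule -/

section Facts

variable {a b : ℝ}

theorem moranLength_pos (ha : 0 < a) (hb : 0 < b) (v : ℕ → Bool) (n : ℕ) :
    0 < moranLength a b v n := by
  induction n with
  | zero => simp [moranLength]
  | succ n ih =>
    simp only [moranLength]
    split_ifs <;> positivity

theorem moran_congr {v w : ℕ → Bool} {n : ℕ} (h : ∀ i < n, w i = v i) :
    moranLength a b w n = moranLength a b v n ∧ moranLeft a b w n = moranLeft a b v n := by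
  induction n with
  | zero => simp [moranLength, moranLeft]
  | succ n ih =>
    obtain ⟨h1, h2⟩ := ih fun i hi => h i (by omega)
    simp [moranLength, moranLeft, h1, h2, h n (by omega)]

theorem moranInterval_congr {v w : ℕ → Bool} {n : ℕ} (h : ∀ i < n, w i = v i) :
    moranInterval a b w n = moranInterval a b v n := by
  simp only [moranInterval, (moran_congr h).1, (moran_congr h).2]

theorem moranLeft_mono (ha : 0 < a) (hb : 0 < b) (hab : a + b < 1) (v : ℕ → Bool) :
    Monotone (moranLeft a b v) := by
  refine monotone_nat_of_le_succ fun n => ?_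
  have := moranLength_pos ha hb v n
  simp only [moranLeft]
  split_ifs
  · nlinarith
  · simp

theorem moranRight_anti (ha : 0 < a) (hb : 0 < b) (hab : a + b < 1) (v : ℕ → Bool) :
    Antitone fun n => moranLeft a b v n + moranLength a b v n := by
  refine antitone_nat_of_succ_le fun n => ?_
  have := moranLength_pos ha hb v n
  simp only [moranLeft, moranLength]
  split_ifs <;> nlinarith

theorem moranLeft_le_right (ha : 0 < a) (hb : 0 < b) (hab : a + b < 1) (v : ℕ → Bool) (m n : ℕ) :
    moranLeft a b v m ≤ moranLeft a b v n + moranLength a b v n := by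
  have h1 := moranLeft_mono ha hb hab v (le_max_left m n)
  have h2 := moranRight_anti ha hb hab v (le_max_right m n)
  have h3 := moranLength_pos ha hb v (max m n)
  simp only at h2
  linarith

theorem moranPoint_mem (ha : 0 < a) (hb : 0 < b) (hab : a + b < 1) (v : ℕ → Bool) (n : ℕ) :
    moranPoint a b v ∈ moranInterval a b v n := by
  have hbdd : BddAbove (Set.range (moranLeft a b v)) := by
    refine ⟨moranLeft a b v 0 + moranLength a b v 0, ?_⟩
    rintro _ ⟨m, rfl⟩
    exact moranLeft_le_right ha hb hab v m 0
  exact ⟨le_ciSup hbdd n, ciSup_le fun m => moranLeft_le_right ha hb hab v m n⟩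

theorem moranInterval_succ_subset (ha : 0 < a) (hb : 0 < b) (hab : a + b < 1) (v : ℕ → Bool)
    (n : ℕ) : moranInterval a b v (n + 1) ⊆ moranInterval a b v n :=
  Set.Icc_subset_Icc (moranLeft_mono ha hb hab v n.le_succ)
    (moranRight_anti ha hb hab v n.le_succ)

theorem moranPoint_mem_iff (ha : 0 < a) (hb : 0 < b) (hab : a + b < 1) (v w : ℕ → Bool) (n : ℕ) :
    moranPoint a b w ∈ moranInterval a b v n ↔ ∀ i < n, w i = v i := by
  refine ⟨fun h => ?_, fun h => moranInterval_congr h ▸ moranPoint_mem ha hb hab w n⟩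
  induction n with
  | zero => simp
  | succ n ih =>
    have hn := ih (moranInterval_succ_subset ha hb hab v n h)
    have hw := moranPoint_mem ha hb hab w (n + 1)
    have hL := moranLength_pos ha hb v n
    intro i hi
    rcases Nat.lt_succ_iff_lt_or_eq.1 hi with hi | rfl
    · exact hn i hi
    · simp only [moranInterval, moranLeft, moranLength, (moran_congr hn).1, (moran_congr hn).2,
        Set.mem_Icc] at h hw
      by_contra hne
      cases hv : v i <;> cases hw' : w i <;> simp_all <;> nlinarith

theorem measurable_moranPoint (a b : ℝ) : Measurable (moranPoint a b) := by
  have hlen : ∀ n, Measurable fun v : ℕ → Bool => moranLength a b v n := by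
    intro n
    induction n with
    | zero => exact measurable_const
    | succ n ih =>
      exact ((Measurable.of_discrete (f := fun c : Bool => if c then b else a)).comp
        (measurable_pi_apply n)).mul ih
  have hleft : ∀ n, Measurable fun v : ℕ → Bool => moranLeft a b v n := by
    intro n
    induction n with
    | zero => exact measurable_const
    | succ n ih =>
      refine ih.add (Measurable.ite ?_ (measurable_const.mul (hlen n)) measurable_const)
      exact (measurable_pi_apply (X := fun _ : ℕ => Bool) n)
        (MeasurableSet.of_discrete (s := {c : Bool | c = true}))
  exact Measurable.iSup hleft

instance isProbabilityMeasure_moranMeasure (a b : ℝ) (p : ℕ → I) :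
    IsProbabilityMeasure (moranMeasure a b p) :=
  Measure.isProbabilityMeasure_map (measurable_moranPoint a b).aemeasurable

theorem moranMeasure_moranInterval (ha : 0 < a) (hb : 0 < b) (hab : a + b < 1) (p : ℕ → I)
    (v : ℕ → Bool) (n : ℕ) :
    moranMeasure a b p (moranInterval a b v n) =
      ∏ i ∈ Finset.range n, ENNReal.ofReal (if v i then 1 - (p i : ℝ) else p i) := by
  have h : moranPoint a b ⁻¹' moranInterval a b v n =
      Set.pi (Finset.range n : Finset ℕ) fun i => {v i} := by
    ext w
    simp [moranPoint_mem_iff ha hb hab, Set.mem_pi]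
  have hI : MeasurableSet (moranInterval a b v n) := measurableSet_Icc
  rw [moranMeasure, Measure.map_apply (measurable_moranPoint a b) hI, h,
    Measure.infinitePi_pi _ fun i _ => MeasurableSet.of_discrete]
  refine Finset.prod_congr rfl fun i _ => ?_
  rw [← ENNReal.ofReal_toReal (measure_ne_top (bernoulliMeasure false true (p i)) {v i})]
  change ENNReal.ofReal ((bernoulliMeasure false true (p i)).real {v i}) = _
  rw [bernoulliMeasure_real_apply (p i) (MeasurableSet.of_discrete)]
  cases v i <;> simp

/-- The mass rule that determines the measure: a left child receives the fraction `p n` of the mass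
of its parent of step `n`, and a right child the fraction `1 - p n`. -/
theorem moranMeasure_moranInterval_succ (ha : 0 < a) (hb : 0 < b) (hab : a + b < 1) (p : ℕ → I)
    (v : ℕ → Bool) (n : ℕ) :
    moranMeasure a b p (moranInterval a b v (n + 1)) =
      ENNReal.ofReal (if v n then 1 - (p n : ℝ) else p n) *
        moranMeasure a b p (moranInterval a b v n) := by
  rw [moranMeasure_moranInterval ha hb hab, moranMeasure_moranInterval ha hb hab,
    Finset.prod_range_succ, mul_comm]

/-- The Moran measure is carried by `C_{ab}`. -/
theorem ae_mem_moranSet (ha : 0 < a) (hb : 0 < b) (hab : a + b < 1) (p : ℕ → I) :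
    ∀ᵐ x ∂(moranMeasure a b p), x ∈ moranSet a b := by
  have hsub : Set.range (moranPoint a b) ⊆ moranSet a b := by
    rintro _ ⟨v, rfl⟩
    exact Set.mem_iInter.2 fun n => Set.mem_iUnion.2 ⟨v, moranPoint_mem ha hb hab v n⟩
  have hmeas : MeasurableSet (moranSet a b) := by
    refine MeasurableSet.iInter fun n => ?_
    have hcover : (⋃ v : ℕ → Bool, moranInterval a b v n) =
        ⋃ u : Fin n → Bool,
          moranInterval a b (fun i => if h : i < n then u ⟨i, h⟩ else false) n := by
      ext x
      simp only [Set.mem_iUnion]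
      refine ⟨fun ⟨v, hv⟩ => ⟨fun i => v i, ?_⟩, fun ⟨u, hu⟩ => ⟨_, hu⟩⟩
      rwa [moranInterval_congr (v := v) fun i hi => by simp [hi]]
    rw [hcover]
    exact MeasurableSet.iUnion fun u => measurableSet_Icc
  exact (ae_map_iff (p := fun x => x ∈ moranSet a b) (measurable_moranPoint a b).aemeasurable
    hmeas).2 (Eventually.of_forall fun v => hsub ⟨v, rfl⟩)

end Facts

end

/-! Write `q i` for the realised probabilities. The proof is a linear programme on single letters:
with `D` the larger of the two candidate values and a suitable multiplier `c`, every choice of child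
satisfies -log(mass ratio) ≤ `D` · (-log(length ratio)) + `c` · (`q i` - 1/2), and each value of `q
i` admits a child with equality. The candidates are the costs of the two extremal strategies over
balanced steps. When `q i = 1 - p` both take the right child, light but long. When `q i = p` one
takes the right child again and the other takes the left child, of mass ratio `p` and length ratio
`a`.

Summing along a word, mass decays at most like length to the power `D`, up to a sum of `q i` - 1/2
over the window of steps between the two scales. Hoeffding and Borel–Cantelli
(`ae_hasSmallWindowSums`) make this sum negligible as soon as the window starting at `j` has length
at least a large multiple of log `j`. A large `Φ` forces exactly such windows, because |log `R`| is
comparable to `j`; this gives `isUpperPhiExponent_moranMeasure`. Following the equality letters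
gives a point where the exponent `D` is needed, `le_of_isUpperPhiExponent_moranMeasure`. The
exceptional null set comes from the window property and the range of the `q i`, so it does not
depend on `Φ`. -/

/-! ### Sums over windows of a random sequence -/

/-- Sums of `y` over windows of length at least a multiple of the logarithm of the starting point
are small compared with the length of the window. -/
def HasSmallWindowSums (y : ℕ → ℝ) : Prop :=
  ∀ ε > 0, ∃ K > 0, ∃ N : ℕ, ∀ j ≥ N, ∀ m : ℕ, K * Real.log (j + 1) ≤ m →
    |∑ i ∈ Finset.range m, y (j + i)| ≤ ε * m

/-- Hoeffding: the sum is sub-Gaussian with parameter `m / 4`, and the factor 2 accounts for the two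
tails. -/
theorem measure_abs_window_sum_ge_le {Ω : Type*} [MeasurableSpace Ω] {P : Measure Ω}
    {Y : ℕ → Ω → ℝ} (hindep : iIndepFun Y P)
    (hsub : ∀ n, HasSubgaussianMGF (Y n) (1 / 4) P) (j m : ℕ) {ε : ℝ} (hε : 0 < ε) :
    P.real {ω | ε * m ≤ |∑ i ∈ Finset.range m, Y (j + i) ω|} ≤
      2 * Real.exp (-(2 * ε ^ 2 * m)) := by
  have := hindep.isProbabilityMeasure
  have hS : HasSubgaussianMGF (fun ω => ∑ i ∈ Finset.range m, Y (j + i) ω)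
      (∑ _i ∈ Finset.range m, (1 / 4)) P :=
    HasSubgaussianMGF.sum_of_iIndepFun (X := fun i => Y (j + i))
      (hindep.precomp (add_right_injective j)) fun i _ => hsub (j + i)
  have hεm : 0 ≤ ε * m := by positivity
  have hexp : -(ε * m) ^ 2 / (2 * ((∑ _i ∈ Finset.range m, (1 / 4) : NNReal) : ℝ)) =
      -(2 * ε ^ 2 * m) := by
    rcases eq_or_ne m 0 with rfl | hm
    · simp
    · have : (m : ℝ) ≠ 0 := by exact_mod_cast hm
      simp
      field_simp
      ring
  have h1 := hS.measure_ge_le hεm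
  have h2 := hS.neg.measure_ge_le hεm
  rw [hexp] at h1 h2
  calc P.real {ω | ε * m ≤ |∑ i ∈ Finset.range m, Y (j + i) ω|}
      ≤ P.real ({ω | ε * m ≤ ∑ i ∈ Finset.range m, Y (j + i) ω} ∪
          {ω | ε * m ≤ (-fun ω => ∑ i ∈ Finset.range m, Y (j + i) ω) ω}) := by
        refine measureReal_mono fun ω hω => ?_
        exact le_abs.1 (show ε * m ≤ |∑ i ∈ Finset.range m, Y (j + i) ω| from hω)
    _ ≤ _ := (measureReal_union_le _ _).trans (by linarith)

/-- Borel–Cantelli over all pairs (start, length): almost surely only finitely many windows above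
the logarithmic threshold are bad. Countably many `ε` of the form 1 / (n + 1) suffice. -/
theorem ae_hasSmallWindowSums {Ω : Type*} [MeasurableSpace Ω] {P : Measure Ω}
    {Y : ℕ → Ω → ℝ} (hindep : iIndepFun Y P)
    (hsub : ∀ n, HasSubgaussianMGF (Y n) (1 / 4) P) :
    ∀ᵐ ω ∂P, HasSmallWindowSums fun n => Y n ω := by
  have := hindep.isProbabilityMeasure
  have key : ∀ n : ℕ, ∀ᵐ ω ∂P, ∃ K > 0, ∃ N : ℕ, ∀ j ≥ N, ∀ m : ℕ, K * Real.log (j + 1) ≤ m →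
      |∑ i ∈ Finset.range m, Y (j + i) ω| ≤ 1 / ((n : ℝ) + 1) * m := by
    intro n
    set ε : ℝ := 1 / ((n : ℝ) + 1)
    have hε : 0 < ε := by positivity
    -- The Hoeffding exponent `2 * ε ^ 2 * m` is split in half: with this `K`, one half yields the
    -- summable factor `(j + 1) ^ (-2)`, the other a geometric series in `m`.
    set K : ℝ := 2 / ε ^ 2 with hK
    let E : ℕ × ℕ → Set Ω := fun jm =>
      {ω | K * Real.log (jm.1 + 1) ≤ jm.2 ∧ ε * jm.2 ≤ |∑ i ∈ Finset.range jm.2, Y (jm.1 + i) ω|}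
    have hbound : ∀ jm, P.real (E jm) ≤
        (1 / ((jm.1 : ℝ) + 1) ^ 2) * (2 * Real.exp (-ε ^ 2) ^ jm.2) := by
      rintro ⟨j, m⟩
      by_cases h : K * Real.log (j + 1) ≤ m
      · refine (measureReal_mono fun ω hω => hω.2).trans
          ((measure_abs_window_sum_ge_le hindep hsub j m hε).trans ?_)
        have hj : (0 : ℝ) < j + 1 := by positivity
        have e1 : 1 / ((j : ℝ) + 1) ^ 2 = Real.exp (-(2 * Real.log (j + 1))) := by
          rw [Real.exp_neg, mul_comm, Real.exp_mul, Real.exp_log hj, one_div]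
          norm_num
        have e2 : Real.exp (-ε ^ 2) ^ m = Real.exp (-(ε ^ 2 * m)) := by
          rw [← Real.exp_nat_mul]; ring_nf
        rw [e1, e2, mul_left_comm, ← Real.exp_add]
        have h3 : 2 * Real.log (j + 1) ≤ ε ^ 2 * m := by
          have := mul_le_mul_of_nonneg_left h (sq_nonneg ε)
          rwa [hK, ← mul_assoc, mul_div_cancel₀ _ (by positivity)] at this
        gcongr
        linarith
      · have : E (j, m) = ∅ := by
          ext ω; simp [E, h]
        rw [this]
        simp
        positivity
    have hsum : Summable fun jm : ℕ × ℕ =>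
        (1 / ((jm.1 : ℝ) + 1) ^ 2) * (2 * Real.exp (-ε ^ 2) ^ jm.2) := by
      refine Summable.mul_of_nonneg (f := fun j : ℕ => 1 / ((j : ℝ) + 1) ^ 2)
        (g := fun m : ℕ => 2 * Real.exp (-ε ^ 2) ^ m) ?_ ?_
        (fun _ => by positivity) (fun _ => by positivity)
      · exact_mod_cast (summable_nat_add_iff 1).2 (Real.summable_one_div_nat_pow.2 one_lt_two)
      · refine (summable_geometric_of_lt_one (Real.exp_pos _).le ?_).mul_left 2
        rw [Real.exp_lt_one_iff]
        have : 0 < ε ^ 2 := by positivity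
        linarith
    have hfin : ∑' jm, P (E jm) ≠ ⊤ := by
      refine ne_top_of_le_ne_top hsum.tsum_ofReal_ne_top (ENNReal.tsum_le_tsum fun jm => ?_)
      rw [← ofReal_measureReal]
      exact ENNReal.ofReal_le_ofReal (hbound jm)
    filter_upwards [ae_finite_setOfPred_mem hfin] with ω hω
    obtain ⟨N, hN⟩ := (hω.image Prod.fst).bddAbove
    refine ⟨K, by positivity, N + 1, fun j hj m hm => ?_⟩
    by_contra! hlt
    have := hN ⟨(j, m), ⟨hm, hlt.le⟩, rfl⟩
    simp at this
    omega
  filter_upwards [ae_all_iff.2 key] with ω hω ε hε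
  obtain ⟨n, hn⟩ := exists_nat_one_div_lt hε
  obtain ⟨K, hK, N, h⟩ := hω n
  exact ⟨K, hK, N, fun j hj m hm => (h j hj m hm).trans (by gcongr)⟩

/-! ### The two-point law of the probabilities -/

theorem integral_uniformOn_pair {α : Type*} [MeasurableSpace α] [MeasurableSingletonClass α]
    {x y : α} (hxy : x ≠ y) (f : α → ℝ) :
    ∫ z, f z ∂(uniformOn {x, y}) = (f x + f y) / 2 := by
  classical
  have hs : ({x, y} : Set α) = (({x, y} : Finset α) : Set α) := by simp
  rw [uniformOn, ProbabilityTheory.cond, integral_smul_measure, hs, setIntegral_finset]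
  · rw [Measure.count_apply_finset, Finset.card_pair hxy, Finset.sum_pair hxy]
    simp
    ring
  · rw [← hs, ← Set.singleton_union]
    exact (integrableOn_singleton (by simp) (by simp)).union
      (integrableOn_singleton (by simp) (by simp))

/-- Hoeffding's lemma on an interval of length 1; the mean is 1/2 because `p` and `1 - p` are
distinct and equally likely. -/
theorem hasSubgaussianMGF_of_map_eq_uniformOn_pair {Ω : Type*} [MeasurableSpace Ω]
    {P : Measure Ω} [IsProbabilityMeasure P] {p : I} (hp : (p : ℝ) < 1 / 2) {X : Ω → I}
    (hX : Measurable X) (hlaw : P.map X = uniformOn {p, σ p}) :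
    HasSubgaussianMGF (fun ω => (X ω : ℝ) - 1 / 2) (1 / 4) P := by
  have hne : p ≠ σ p := by
    intro h
    have := congrArg (fun t : I => (t : ℝ)) h
    simp at this
    linarith
  have hmem : ∀ᵐ ω ∂P, (X ω : ℝ) - 1 / 2 ∈ Set.Icc (-(1 / 2) : ℝ) (1 / 2) :=
    ae_of_all _ fun ω => ⟨by linarith [(X ω).2.1], by linarith [(X ω).2.2]⟩
  have hmeas : Measurable fun t : I => (t : ℝ) - 1 / 2 := measurable_subtype_coe.sub_const _
  have hint : P[fun ω => (X ω : ℝ) - 1 / 2] = 0 := by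
    have h := integral_map (μ := P) hX.aemeasurable (f := fun t : I => (t : ℝ) - 1 / 2)
      hmeas.aestronglyMeasurable
    rw [← h, hlaw, integral_uniformOn_pair hne]
    simp
    ring
  have h := hasSubgaussianMGF_of_mem_Icc_of_integral_eq_zero
    (hmeas.comp hX).aemeasurable hmem hint
  have hc : ((‖(1 / 2 : ℝ) - -(1 / 2)‖₊ / 2) ^ 2 : NNReal) = 1 / 4 := by
    rw [← NNReal.coe_inj]
    norm_num
  rwa [hc] at h

theorem ae_mem_of_map_eq_uniformOn {Ω α : Type*} [MeasurableSpace Ω] [MeasurableSpace α]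
    {P : Measure Ω} {X : Ω → α} (hX : Measurable X) {s : Set α} (hs : MeasurableSet s)
    (hlaw : P.map X = uniformOn s) : ∀ᵐ ω ∂P, X ω ∈ s := by
  have h : ∀ᵐ x ∂(P.map X), x ∈ s := by
    rw [hlaw]
    exact ae_cond_mem hs
  exact ae_of_ae_map hX.aemeasurable h

/-! ### Balls and Moran intervals -/

section Geometry

variable {a b : ℝ}

/-- Mass that `moranMeasure a b q` gives to the Moran interval of step `n` along `v`. -/
def moranMass (q : ℕ → I) (v : ℕ → Bool) (n : ℕ) : ℝ :=
  ∏ i ∈ Finset.range n, (if v i then 1 - (q i : ℝ) else q i)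

theorem moranMass_pos {q : ℕ → I} (hq : ∀ i, (q i : ℝ) ∈ Set.Ioo 0 1) (v : ℕ → Bool) (n : ℕ) :
    0 < moranMass q v n := by
  refine Finset.prod_pos fun i _ => ?_
  have := hq i
  split_ifs <;> linarith [this.1, this.2]

theorem moranMeasure_moranInterval_eq_ofReal (ha : 0 < a) (hb : 0 < b) (hab : a + b < 1)
    (q : ℕ → I) (v : ℕ → Bool) (n : ℕ) :
    moranMeasure a b q (moranInterval a b v n) = ENNReal.ofReal (moranMass q v n) := by
  rw [moranMeasure_moranInterval ha hb hab, moranMass, ENNReal.ofReal_prod_of_nonneg]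
  intro i _
  split_ifs
  · linarith [(q i).2.2]
  · exact (q i).2.1

theorem moranLength_le_pow (ha : 0 < a) (hab : a < b) (v : ℕ → Bool) (n : ℕ) :
    moranLength a b v n ≤ b ^ n := by
  induction n with
  | zero => simp [moranLength]
  | succ n ih =>
    have h := moranLength_pos ha (ha.trans hab) v n
    rw [moranLength, pow_succ']
    refine mul_le_mul ?_ ih h.le (ha.trans hab).le
    split_ifs
    exacts [le_rfl, hab.le]

theorem moranLength_anti (ha : 0 < a) (hb : 0 < b) (hab : a + b < 1) (v : ℕ → Bool) :
    Antitone (moranLength a b v) := by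
  refine antitone_nat_of_succ_le fun n => ?_
  have h := moranLength_pos ha hb v n
  rw [moranLength]
  split_ifs <;> nlinarith

theorem moranInterval_anti (ha : 0 < a) (hb : 0 < b) (hab : a + b < 1) (v : ℕ → Bool) :
    Antitone (moranInterval a b v) :=
  antitone_nat_of_succ_le fun n => moranInterval_succ_subset ha hb hab v n

/-- The union over words is closed, since only finitely many intervals of step `n` are distinct, and
it has full measure. -/
theorem exists_mem_moranInterval_of_mem_support (ha : 0 < a) (hb : 0 < b) (hab : a + b < 1)
    {q : ℕ → I} {x : ℝ} (hx : x ∈ (moranMeasure a b q).support) (n : ℕ) :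
    ∃ v : ℕ → Bool, x ∈ moranInterval a b v n := by
  have hclosed : IsClosed (⋃ v : ℕ → Bool, moranInterval a b v n) := by
    have hcover : (⋃ v : ℕ → Bool, moranInterval a b v n) =
        ⋃ u : Fin n → Bool,
          moranInterval a b (fun i => if h : i < n then u ⟨i, h⟩ else false) n := by
      ext x
      simp only [Set.mem_iUnion]
      refine ⟨fun ⟨v, hv⟩ => ⟨fun i => v i, ?_⟩, fun ⟨u, hu⟩ => ⟨_, hu⟩⟩
      rwa [moranInterval_congr (v := v) fun i hi => by simp [hi]]
    rw [hcover]
    exact isClosed_iUnion_of_finite fun u => isClosed_Icc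
  have hae : (⋃ v : ℕ → Bool, moranInterval a b v n) ∈ ae (moranMeasure a b q) := by
    filter_upwards [ae_mem_moranSet ha hb hab q] with y hy
    exact Set.mem_iInter.1 hy n
  exact Set.mem_iUnion.1 (Measure.support_subset_of_isClosed hclosed hae hx)

theorem moranInterval_subset_ball {v : ℕ → Bool} {n : ℕ} {x r : ℝ}
    (hx : x ∈ moranInterval a b v n) (hr : moranLength a b v n < r) :
    moranInterval a b v n ⊆ Metric.ball x r := by
  intro y hy
  simp only [moranInterval, Set.mem_Icc] at hx hy
  rw [Metric.mem_ball, Real.dist_eq, abs_lt]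
  constructor <;> linarith

/-- Points of two siblings are separated by the gap between them. -/
theorem le_abs_sub_of_ne (ha : 0 < a) (hb : 0 < b) {v w : ℕ → Bool} {n : ℕ}
    (hvw : ∀ i < n, w i = v i) (hn : w n ≠ v n) {x y : ℝ}
    (hx : x ∈ moranInterval a b v (n + 1)) (hy : y ∈ moranInterval a b w (n + 1)) :
    (1 - a - b) * moranLength a b v n ≤ |y - x| := by
  have hL := moranLength_pos ha hb v n
  simp only [moranInterval, moranLeft, moranLength, (moran_congr hvw).1, (moran_congr hvw).2,
    Set.mem_Icc] at hx hy
  cases hv : v n <;> cases hw : w n <;> simp_all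
  · exact le_abs.2 (Or.inl (by linarith))
  · exact le_abs.2 (Or.inr (by linarith))

/-- At the first letter before `j` where an address leaves `v`, its point is already separated from
`x` by a gap of size at least `R`. -/
theorem moranMeasure_ball_le (ha : 0 < a) (hb : 0 < b) (hab : a + b < 1) (q : ℕ → I)
    {v : ℕ → Bool} {j : ℕ} {x R : ℝ} (hx : x ∈ moranInterval a b v j)
    (hR : ∀ i < j, R ≤ (1 - a - b) * moranLength a b v i) :
    moranMeasure a b q (Metric.ball x R) ≤ ENNReal.ofReal (moranMass q v j) := by
  rw [← moranMeasure_moranInterval_eq_ofReal ha hb hab, moranMeasure,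
    Measure.map_apply (measurable_moranPoint a b) measurableSet_ball,
    Measure.map_apply (measurable_moranPoint a b) (show MeasurableSet (moranInterval a b v j) from
      measurableSet_Icc)]
  refine measure_mono fun w hw => ?_
  rw [Set.mem_preimage, moranPoint_mem_iff ha hb hab]
  intro i
  induction i using Nat.strong_induction_on with
  | _ i ih =>
    intro hi
    by_contra hne
    have h := le_abs_sub_of_ne ha hb (fun l hl => ih l hl (hl.trans hi)) hne
      (moranInterval_anti ha hb hab v hi hx) (moranPoint_mem ha hb hab w (i + 1))
    rw [Set.mem_preimage, Metric.mem_ball, Real.dist_eq] at hw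
    linarith [hR i hi]

theorem ofReal_moranMass_le_moranMeasure_ball (ha : 0 < a) (hb : 0 < b) (hab : a + b < 1)
    (q : ℕ → I) {v : ℕ → Bool} {n : ℕ} {x r : ℝ} (hx : x ∈ moranInterval a b v n)
    (hr : moranLength a b v n < r) :
    ENNReal.ofReal (moranMass q v n) ≤ moranMeasure a b q (Metric.ball x r) := by
  rw [← moranMeasure_moranInterval_eq_ofReal ha hb hab]
  exact measure_mono (moranInterval_subset_ball hx hr)

theorem exists_moranLength_lt (ha : 0 < a) (hab : a < b) (hsum : a + b < 1) (v : ℕ → Bool) {r : ℝ}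
    (hr : 0 < r) : ∃ n, moranLength a b v n < r := by
  obtain ⟨n, hn⟩ := exists_pow_lt_of_lt_one hr (show b < 1 by linarith)
  exact ⟨n, (moranLength_le_pow ha hab v n).trans_lt hn⟩

theorem moranPoint_mem_support (ha : 0 < a) (hab : a < b) (hsum : a + b < 1) {q : ℕ → I}
    (hq : ∀ i, (q i : ℝ) ∈ Set.Ioo 0 1) (v : ℕ → Bool) :
    moranPoint a b v ∈ (moranMeasure a b q).support := by
  refine Metric.nhds_basis_ball.mem_measureSupport.2 fun r hr => ?_
  obtain ⟨n, hn⟩ := exists_moranLength_lt ha hab hsum v hr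
  exact (ENNReal.ofReal_pos.2 (moranMass_pos hq v n)).trans_le
    (ofReal_moranMass_le_moranMeasure_ball ha (ha.trans hab) hsum q
      (moranPoint_mem ha (ha.trans hab) hsum v n) hn)

/-! ### Logarithmic estimates along a word -/

theorem log_moranLength_succ (ha : 0 < a) (hb : 0 < b) (v : ℕ → Bool) (n : ℕ) :
    Real.log (moranLength a b v (n + 1)) =
      Real.log (if v n then b else a) + Real.log (moranLength a b v n) := by
  rw [moranLength, Real.log_mul _ (moranLength_pos ha hb v n).ne']
  split_ifs
  exacts [hb.ne', ha.ne']

theorem log_moranMass_succ {q : ℕ → I} (hq : ∀ i, (q i : ℝ) ∈ Set.Ioo 0 1) (v : ℕ → Bool) (n : ℕ) :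
    Real.log (moranMass q v (n + 1)) =
      Real.log (moranMass q v n) + Real.log (if v n then 1 - (q n : ℝ) else q n) := by
  rw [moranMass, Finset.prod_range_succ, ← moranMass, Real.log_mul (moranMass_pos hq v n).ne']
  have := hq n
  split_ifs
  exacts [by linarith [this.2], this.1.ne']

theorem log_moranLength_sub_le (ha : 0 < a) (hab : a < b) (v : ℕ → Bool) (j m : ℕ) :
    Real.log (moranLength a b v j) - Real.log (moranLength a b v (j + m)) ≤
      m * -Real.log a := by
  induction m with
  | zero => simp
  | succ m ih =>
    rw [← add_assoc, log_moranLength_succ ha (ha.trans hab)]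
    have : Real.log a ≤ Real.log (if v (j + m) then b else a) := by
      split_ifs
      exacts [Real.log_le_log ha hab.le, le_rfl]
    push_cast
    linarith

theorem le_log_moranLength_sub (ha : 0 < a) (hab : a < b) (v : ℕ → Bool) (j m : ℕ) :
    m * -Real.log b ≤
      Real.log (moranLength a b v j) - Real.log (moranLength a b v (j + m)) := by
  induction m with
  | zero => simp
  | succ m ih =>
    rw [← add_assoc, log_moranLength_succ ha (ha.trans hab)]
    have : Real.log (if v (j + m) then b else a) ≤ Real.log b := by
      split_ifs
      exacts [le_rfl, Real.log_le_log ha hab.le]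
    push_cast
    linarith

/-- The single-letter inequality, telescoped. The random part of the error does not depend on the
word, so later bounds are uniform in `v`. -/
theorem log_moranMass_sub_le (ha : 0 < a) (hb : 0 < b) {q : ℕ → I}
    (hq : ∀ i, (q i : ℝ) ∈ Set.Ioo 0 1) {D c : ℝ}
    (hD : ∀ i (l : Bool), -Real.log (if l then 1 - (q i : ℝ) else q i) ≤
      D * -Real.log (if l then b else a) + c * ((q i : ℝ) - 1 / 2)) (v : ℕ → Bool) (j m : ℕ) :
    Real.log (moranMass q v j) - Real.log (moranMass q v (j + m)) ≤
      D * (Real.log (moranLength a b v j) - Real.log (moranLength a b v (j + m))) +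
        c * ∑ i ∈ Finset.range m, ((q (j + i) : ℝ) - 1 / 2) := by
  induction m with
  | zero => simp
  | succ m ih =>
    rw [← add_assoc, log_moranLength_succ ha hb, log_moranMass_succ hq, Finset.sum_range_succ]
    linarith [hD (j + m) (v (j + m))]

theorem neg_log_moranMass_eq (ha : 0 < a) (hb : 0 < b) {q : ℕ → I}
    (hq : ∀ i, (q i : ℝ) ∈ Set.Ioo 0 1) {D c : ℝ} {v : ℕ → Bool}
    (hv : ∀ i, -Real.log (if v i then 1 - (q i : ℝ) else q i) =
      D * -Real.log (if v i then b else a) + c * ((q i : ℝ) - 1 / 2)) (n : ℕ) :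
    -Real.log (moranMass q v n) =
      D * -Real.log (moranLength a b v n) + c * ∑ i ∈ Finset.range n, ((q i : ℝ) - 1 / 2) := by
  induction n with
  | zero => simp [moranMass, moranLength]
  | succ n ih =>
    rw [log_moranLength_succ ha hb, log_moranMass_succ hq, Finset.sum_range_succ]
    linarith [hv n]

end Geometry

/-! ### The upper dimension of the Moran measure -/

section Dimension

variable {a b : ℝ}

/-- A large dimension function is bounded below by arbitrarily large multiples of
`log |log t| / |log t|`. -/
theorem IsLargeDimensionFunction.exists_forall_le {Φ : ℝ → ℝ} (hΦ : IsLargeDimensionFunction Φ)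
    (h : ℝ) : ∃ δ > 0, ∀ t, 0 < t → t < δ → 1 < |Real.log t| →
      h * Real.log |Real.log t| ≤ Φ t * |Real.log t| := by
  obtain ⟨H, hH, hΦH⟩ := hΦ
  obtain ⟨δ, hδ, hsub⟩ := mem_nhdsGT_iff_exists_Ioo_subset.1
    ((hH.eventually_ge_atTop h).and hΦH)
  refine ⟨δ, hδ, fun t ht htδ hlog => ?_⟩
  obtain ⟨h1, h2⟩ := hsub ⟨ht, htδ⟩
  have hpos : |Real.log t| ≠ 0 := by positivity
  rw [h2, mul_assoc, div_mul_cancel₀ _ hpos]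
  exact mul_le_mul_of_nonneg_right h1 (Real.log_nonneg hlog.le)

/-- Used with `B = -log b`, where `(j - 1) * B` bounds |log `R`| from below: it turns log |log `R`|
into log (`j` + 1) at the cost of a factor 2. -/
theorem exists_forall_log_succ_le_log_pred_mul {B : ℝ} (hB : 0 < B) :
    ∃ N : ℕ, ∀ j ≥ N, 1 ≤ Real.log ((j : ℝ) + 1) ∧ 1 < ((j : ℝ) - 1) * B ∧
      Real.log ((j : ℝ) + 1) / 2 ≤ Real.log (((j : ℝ) - 1) * B) := by
  have ht : Tendsto (fun j : ℕ => (j : ℝ) + 1) atTop atTop :=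
    tendsto_atTop_add_const_right _ _ tendsto_natCast_atTop_atTop
  have hev := ((Real.tendsto_log_atTop.comp ht).eventually_ge_atTop
    (max 1 (-2 * Real.log (B / 2)))).and (ht.eventually_ge_atTop (max 4 (4 / B)))
  obtain ⟨N, hN⟩ := eventually_atTop.1 hev
  refine ⟨N, fun j hj => ?_⟩
  obtain ⟨h1, h2⟩ := hN j hj
  simp only [Function.comp_apply, max_le_iff] at h1 h2
  have hle : ((j : ℝ) + 1) * (B / 2) ≤ ((j : ℝ) - 1) * B := by nlinarith [h2.1]
  have hpos : 0 < (j : ℝ) + 1 := by linarith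
  have h4 : 4 ≤ ((j : ℝ) + 1) * B := by
    have := h2.2
    rwa [div_le_iff₀ hB] at this
  refine ⟨h1.1, by linarith, ?_⟩
  have := Real.log_le_log (by positivity) hle
  rw [Real.log_mul hpos.ne' (by positivity)] at this
  linarith [h1.2]

/-! ### Upper bound for the dimension -/

theorem exists_forall_log_moranMass_sub_le (ha : 0 < a) (hab : a < b) (hsum : a + b < 1)
    {q : ℕ → I} (hq : ∀ i, (q i : ℝ) ∈ Set.Ioo 0 1)
    (hwin : HasSmallWindowSums fun i => (q i : ℝ) - 1 / 2) {D c : ℝ}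
    (hD : ∀ i (l : Bool), -Real.log (if l then 1 - (q i : ℝ) else q i) ≤
      D * -Real.log (if l then b else a) + c * ((q i : ℝ) - 1 / 2)) {d : ℝ} (hDd : D < d) :
    ∃ K > 0, ∃ N : ℕ, ∀ j ≥ N, ∀ m : ℕ, K * Real.log (j + 1) ≤ m → ∀ v : ℕ → Bool,
      Real.log (moranMass q v j) - Real.log (moranMass q v (j + m)) ≤
        d * (Real.log (moranLength a b v j) - Real.log (moranLength a b v (j + m))) := by
  have hb := ha.trans hab
  have hB : 0 < -Real.log b := neg_pos.2 (Real.log_neg hb (by linarith))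
  -- Each step shrinks the length by at least the factor `b`, so the slack `d - D` gains at least
  -- `(d - D) * -log b` per step, enough to absorb the random error. The `+ 1` covers `c = 0`.
  set ε := (d - D) * -Real.log b / (|c| + 1) with hε
  have hε0 : 0 < ε := div_pos (mul_pos (sub_pos.2 hDd) hB) (by positivity)
  obtain ⟨K, hK, N, h⟩ := hwin ε hε0
  refine ⟨K, hK, N, fun j hj m hm v => ?_⟩
  have hc : c * ∑ i ∈ Finset.range m, ((q (j + i) : ℝ) - 1 / 2) ≤ (d - D) * (m * -Real.log b) :=
    calc _ ≤ |c| * |∑ i ∈ Finset.range m, ((q (j + i) : ℝ) - 1 / 2)| := by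
            rw [← abs_mul]; exact le_abs_self _
      _ ≤ (|c| + 1) * (ε * m) := by
            gcongr
            · linarith
            · exact h j hj m hm
      _ = _ := by rw [hε]; field_simp
  have h1 := log_moranMass_sub_le ha hb hq hD v j m
  have h2 := mul_le_mul_of_nonneg_left (le_log_moranLength_sub ha hab v j m) (sub_pos.2 hDd).le
  linarith

theorem isUpperPhiExponent_moranMeasure (ha : 0 < a) (hab : a < b) (hsum : a + b < 1)
    {q : ℕ → I} (hq : ∀ i, (q i : ℝ) ∈ Set.Ioo 0 1)
    (hwin : HasSmallWindowSums fun i => (q i : ℝ) - 1 / 2) {D c : ℝ}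
    (hD : ∀ i (l : Bool), -Real.log (if l then 1 - (q i : ℝ) else q i) ≤
      D * -Real.log (if l then b else a) + c * ((q i : ℝ) - 1 / 2)) {d : ℝ} (hDd : D < d)
    (hd : 0 ≤ d) {Φ : ℝ → ℝ} (hΦ : IsLargeDimensionFunction Φ) :
    IsUpperPhiExponent Φ (moranMeasure a b q) d := by
  have hb := ha.trans hab
  have hA : 0 < -Real.log a := neg_pos.2 (Real.log_neg ha (by linarith))
  have hB : 0 < -Real.log b := neg_pos.2 (Real.log_neg hb (by linarith))
  set θ := 1 - a - b with hθ
  have hθ0 : 0 < θ := by linarith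
  have hθ1 : Real.log θ < 0 := Real.log_neg hθ0 (by linarith)
  obtain ⟨K, hK, N₁, hmass⟩ := exists_forall_log_moranMass_sub_le ha hab hsum hq hwin hD hDd
  -- In the multiple of log |log `R`| requested from `Φ` below, the factor 2 pays for the halving in
  -- `hlog`, and `K + 1` instead of `K` pays for the step lost in locating `R` between consecutive
  -- lengths.
  obtain ⟨N₂, hlog⟩ := exists_forall_log_succ_le_log_pred_mul hB
  obtain ⟨δ, hδ, hlarge⟩ := hΦ.exists_forall_le (2 * (-Real.log a * (K + 1)))
  set N := max (max N₁ N₂) 1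
  set C := -Real.log θ - Real.log a
  -- The second bound says `R ≤ θ * a ^ N`, which forces the index `j` of the large ball to be at
  -- least `N`. The constant `C` collects the gap factor `θ` at scale `R` and one factor `a` at
  -- scale `r`.
  refine ⟨min (δ / 2) (Real.exp (Real.log θ - N * -Real.log a)), by positivity,
    Real.exp (d * C), by positivity, fun r R hR hr hrR hRR hRC x hx => ?_⟩
  have hR0 : 0 < R := hR.1
  have hRδ : R < δ := by linarith [hRC.trans (min_le_left _ _)]
  have hlogR : Real.log R ≤ Real.log θ - N * -Real.log a := by
    rw [Real.log_le_iff_le_exp hR0]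
    exact hRC.trans (min_le_right _ _)
  have hlogR0 : Real.log R < 0 := Real.log_neg hR0 hR.2
  have hlogr : Real.log r < Real.log R + Φ R * Real.log R := by
    have := Real.log_lt_log hr hrR
    rw [Real.log_rpow hR0] at this
    linarith
  -- an interval `I_k` inside the small ball
  obtain ⟨n₀, hn₀⟩ := exists_pow_lt_of_lt_one hr (show b < 1 by linarith)
  -- Only a finite address of `x` is needed: `b ^ n₀ < r` bounds all lengths of step `n₀`, so both
  -- indices `j ≤ k` are at most `n₀`, whichever word is obtained.
  obtain ⟨v, hxv⟩ := exists_mem_moranInterval_of_mem_support ha hb hsum hx n₀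
  have hlen := moranLength_pos (a := a) (b := b) ha hb v
  have hex : ∃ n, moranLength a b v n < r := ⟨n₀, (moranLength_le_pow ha hab v n₀).trans_lt hn₀⟩
  set k := Nat.find hex
  have hk : moranLength a b v k < r := Nat.find_spec hex
  have hxk : x ∈ moranInterval a b v k :=
    moranInterval_anti ha hb hsum v (Nat.find_min' hex <|
      (moranLength_le_pow ha hab v n₀).trans_lt hn₀) hxv
  have hLk : Real.log r + Real.log a ≤ Real.log (moranLength a b v k) := by
    obtain ⟨k', hk'⟩ : ∃ k', k = k' + 1 := by
      refine Nat.exists_eq_succ_of_ne_zero fun h0 => ?_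
      rw [h0] at hk
      simp only [moranLength] at hk
      linarith [hR.2]
    have h1 : r ≤ moranLength a b v k' := not_lt.1 (Nat.find_min hex (by omega))
    have h2 := log_moranLength_sub_le ha hab v k' 1
    have h3 := Real.log_le_log hr h1
    rw [hk']
    push_cast at h2
    linarith
  have hLk' : Real.log (moranLength a b v k) < Real.log r := Real.log_lt_log (hlen k) hk
  -- an interval `I_j` that contains all mass of the large ball
  have hexj : ∃ n, θ * moranLength a b v n < R := ⟨k, by nlinarith [hlen k]⟩
  set j := Nat.find hexj
  have hj : θ * moranLength a b v j < R := Nat.find_spec hexj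
  have hjk : j ≤ k := Nat.find_min' hexj (by nlinarith [hlen k])
  have hjmin : ∀ i < j, R ≤ θ * moranLength a b v i := fun i hi => not_lt.1 (Nat.find_min hexj hi)
  have hLj : Real.log θ + Real.log (moranLength a b v j) < Real.log R := by
    rw [← Real.log_mul hθ0.ne' (hlen j).ne']
    exact Real.log_lt_log (mul_pos hθ0 (hlen j)) hj
  have hNj : N ≤ j := by
    have h1 := log_moranLength_sub_le ha hab v 0 j
    rw [zero_add] at h1
    simp only [moranLength, Real.log_one] at h1
    have h2 : (N : ℝ) * -Real.log a ≤ j * -Real.log a := by linarith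
    exact_mod_cast le_of_mul_le_mul_right h2 hA
  obtain ⟨j', hj'⟩ : ∃ j', j = j' + 1 :=
    Nat.exists_eq_succ_of_ne_zero (by have : 1 ≤ N := le_max_right _ _; omega)
  have hLj' : Real.log R ≤ Real.log θ + Real.log (moranLength a b v j') := by
    rw [← Real.log_mul hθ0.ne' (hlen j').ne']
    exact Real.log_le_log hR0 (hjmin j' (by omega))
  have hLj_ge : Real.log R + Real.log a ≤ Real.log (moranLength a b v j) := by
    have h2 := log_moranLength_sub_le ha hab v j' 1
    rw [hj']
    push_cast at h2
    linarith
  -- the number of steps between them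
  obtain ⟨m, hm⟩ := Nat.exists_eq_add_of_le hjk
  have hKm : K * Real.log (j + 1) ≤ m := by
    have hcast : (j : ℝ) - 1 = j' := by rw [hj']; push_cast; ring
    obtain ⟨g1, g2, g3⟩ := hlog j ((le_max_right _ _).trans ((le_max_left _ _).trans hNj))
    have h1 := le_log_moranLength_sub ha hab v 0 j'
    rw [zero_add] at h1
    simp only [moranLength, Real.log_one] at h1
    have habs : |Real.log R| = -Real.log R := abs_of_neg hlogR0
    have h2 : ((j : ℝ) - 1) * -Real.log b ≤ |Real.log R| := by rw [hcast, habs]; linarith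
    have h3 := hlarge R hR0 hRδ (g2.trans_le h2)
    have h4 := Real.log_le_log (by linarith) h2
    have h5 : -Real.log a * (K + 1) * Real.log (j + 1) ≤ Φ R * |Real.log R| := by
      refine le_trans ?_ h3
      have : 0 ≤ -Real.log a * (K + 1) := by positivity
      nlinarith
    have h6 := log_moranLength_sub_le ha hab v j m
    rw [← hm] at h6
    rw [habs] at h5
    have h7 : -Real.log a * (K * Real.log (j + 1)) ≤ -Real.log a * m := by
      nlinarith
    exact le_of_mul_le_mul_left h7 hA
  have hmain := hmass j ((le_max_left _ _).trans ((le_max_left _ _).trans hNj)) m hKm v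
  rw [← hm] at hmain
  have hMj := moranMass_pos hq v j
  have hMk := moranMass_pos hq v k
  calc _ ≤ ENNReal.ofReal (moranMass q v j) / ENNReal.ofReal (moranMass q v k) :=
        ENNReal.div_le_div
          (moranMeasure_ball_le ha hb hsum q (moranInterval_anti ha hb hsum v hjk hxk) hjmin)
          (ofReal_moranMass_le_moranMeasure_ball ha hb hsum q hxk hk)
    _ = ENNReal.ofReal (moranMass q v j / moranMass q v k) := (ENNReal.ofReal_div_of_pos hMk).symm
    _ ≤ _ := by
        refine ENNReal.ofReal_le_ofReal ?_
        rw [Real.rpow_def_of_pos (div_pos hR0 hr), ← Real.exp_add,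
          ← Real.log_le_iff_le_exp (div_pos hMj hMk), Real.log_div hMj.ne' hMk.ne',
          Real.log_div hR0.ne' hr.ne']
        have : d * (Real.log (moranLength a b v j) - Real.log (moranLength a b v k)) ≤
            d * (C + (Real.log R - Real.log r)) := by
          refine mul_le_mul_of_nonneg_left ?_ hd
          linarith
        linarith

/-! ### Lower bound for the dimension -/

/-- At the point whose letters all attain equality, `R` is kept fixed and `r` tends to 0: mass then
decays like length to the power `D`, up to an arbitrarily small loss in the exponent. -/
theorem le_of_isUpperPhiExponent_moranMeasure (ha : 0 < a) (hab : a < b) (hsum : a + b < 1)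
    {q : ℕ → I} (hq : ∀ i, (q i : ℝ) ∈ Set.Ioo 0 1)
    (hwin : HasSmallWindowSums fun i => (q i : ℝ) - 1 / 2) {D c : ℝ}
    (hD : ∀ i, ∃ l : Bool, -Real.log (if l then 1 - (q i : ℝ) else q i) =
      D * -Real.log (if l then b else a) + c * ((q i : ℝ) - 1 / 2)) {d : ℝ}
    {Φ : ℝ → ℝ} (hΦ : IsDimensionFunction Φ)
    (hd : IsUpperPhiExponent Φ (moranMeasure a b q) d) : D ≤ d := by
  have hb := ha.trans hab
  have hB : 0 < -Real.log b := neg_pos.2 (Real.log_neg hb (by linarith))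
  by_contra! hdD
  choose v hv using hD
  set θ := 1 - a - b with hθ
  have hθ0 : 0 < θ := by linarith
  have hθ1 : θ < 1 := by linarith
  have hlen := moranLength_pos (a := a) (b := b) ha hb v
  set x := moranPoint a b v
  obtain ⟨C₁, hC₁, C₂, hC₂, hexp⟩ := hd
  set R := min C₁ (1 / 2) with hR
  have hR0 : 0 < R := by positivity
  have hR1 : R < 1 := (min_le_right _ _).trans_lt (by norm_num)
  have hRmem : R ∈ Set.Ioo (0 : ℝ) 1 := ⟨hR0, hR1⟩
  have hRR : R ^ (1 + Φ R) ≤ R := by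
    conv_rhs => rw [← Real.rpow_one R]
    exact Real.rpow_le_rpow_of_exponent_ge hR0 hR1.le (by linarith [hΦ.nonneg R hRmem])
  have hxmem := moranPoint_mem ha hb hsum v
  obtain ⟨k₀, hk₀⟩ := exists_moranLength_lt ha hab hsum v hR0
  have hM₀ := moranMass_pos hq v k₀
  -- the upper bound for the ratio of the masses, from the exponent `d`
  have hupper : ∀ᶠ n in atTop, Real.log (moranMass q v k₀) - Real.log (moranMass q v n) ≤
      Real.log C₂ + d * (Real.log R - Real.log θ - Real.log (moranLength a b v n)) := by
    obtain ⟨n₀, hn₀⟩ := exists_moranLength_lt ha hab hsum v (Real.rpow_pos_of_pos hR0 (1 + Φ R))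
    filter_upwards [eventually_ge_atTop n₀] with n hn
    have hMn := moranMass_pos hq v n
    -- The radius `r = θ * moranLength a b v n` is at most every gap met before step `n`, so the
    -- small ball carries no mass outside the interval of step `n`.
    have hr0 : 0 < θ * moranLength a b v n := mul_pos hθ0 (hlen n)
    have hr : θ * moranLength a b v n < R ^ (1 + Φ R) := by
      have := moranLength_anti ha hb hsum v hn
      nlinarith [hlen n]
    have h := hexp _ R hRmem hr0 hr hRR (min_le_left _ _) x
      (moranPoint_mem_support ha hab hsum hq v)
    have h' : ENNReal.ofReal (moranMass q v k₀ / moranMass q v n) ≤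
        ENNReal.ofReal (C₂ * (R / (θ * moranLength a b v n)) ^ d) := by
      refine le_trans ?_ h
      rw [ENNReal.ofReal_div_of_pos hMn]
      refine ENNReal.div_le_div (ofReal_moranMass_le_moranMeasure_ball ha hb hsum q (hxmem k₀) hk₀)
        (moranMeasure_ball_le ha hb hsum q (hxmem n) fun i hi => ?_)
      exact mul_le_mul_of_nonneg_left (moranLength_anti ha hb hsum v hi.le) hθ0.le
    have hpos : 0 < R / (θ * moranLength a b v n) := by positivity
    rw [ENNReal.ofReal_le_ofReal_iff (by positivity)] at h'
    have h'' := Real.log_le_log (div_pos hM₀ hMn) h'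
    rw [Real.log_div hM₀.ne' hMn.ne', Real.log_mul hC₂.ne' (by positivity), Real.log_rpow hpos,
      Real.log_div hR0.ne' hr0.ne', Real.log_mul hθ0.ne' (hlen n).ne'] at h''
    linarith
  -- the lower bound, from the balanced digits
  set ε := (D - d) * -Real.log b / (2 * (|c| + 1)) with hε
  have hε0 : 0 < ε := div_pos (mul_pos (sub_pos.2 hdD) hB) (by positivity)
  obtain ⟨K, hK, N, hwin⟩ := hwin ε hε0
  -- The first `N` steps escape the window bound and cost a constant. The later ones cost at most
  -- half of `D - d`, which leaves the rate `(D + d) / 2 > d`.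
  set S := |∑ i ∈ Finset.range N, ((q i : ℝ) - 1 / 2)|
  have hlower : ∀ᶠ m : ℕ in atTop, (D + d) / 2 * -Real.log (moranLength a b v (N + m)) -
      |c| * S ≤ -Real.log (moranMass q v (N + m)) := by
    filter_upwards [tendsto_natCast_atTop_atTop.eventually_ge_atTop (K * Real.log (N + 1))]
      with m hm
    have h1 := neg_log_moranMass_eq ha hb hq hv (N + m)
    rw [Finset.sum_range_add, mul_add] at h1
    have h2 : -(|c| * S) ≤ c * ∑ i ∈ Finset.range N, ((q i : ℝ) - 1 / 2) := by
      rw [← abs_mul]; exact neg_abs_le _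
    have h3 : -((D - d) / 2 * (m * -Real.log b)) ≤
        c * ∑ i ∈ Finset.range m, ((q (N + i) : ℝ) - 1 / 2) := by
      refine le_trans ?_ (neg_abs_le _)
      rw [abs_mul, neg_le_neg_iff]
      calc |c| * |∑ i ∈ Finset.range m, ((q (N + i) : ℝ) - 1 / 2)| ≤ (|c| + 1) * (ε * m) := by
            gcongr
            · linarith
            · exact hwin N le_rfl m hm
        _ = _ := by rw [hε]; field_simp
    have h4 := le_log_moranLength_sub ha hab v 0 (N + m)
    rw [zero_add] at h4
    simp only [moranLength, Real.log_one] at h4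
    push_cast at h4
    have h5 : (m : ℝ) * -Real.log b ≤ -Real.log (moranLength a b v (N + m)) := by
      have : 0 ≤ (N : ℝ) * -Real.log b := by positivity
      linarith
    have h6 := mul_le_mul_of_nonneg_left h5 (show 0 ≤ (D - d) / 2 by linarith)
    linarith
  -- comparison
  have hNm : Tendsto (fun m => N + m) atTop atTop := 
    tendsto_atTop_mono (fun m => Nat.le_add_left m N) tendsto_id
  have hgrow : Tendsto (fun m : ℕ => (D - d) / 2 * ((m : ℝ) * -Real.log b)) atTop atTop :=
    (tendsto_natCast_atTop_atTop.atTop_mul_const hB).const_mul_atTop (by linarith)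
  obtain ⟨m, h1, h2, h3⟩ := ((hNm.eventually hupper).and (hlower.and
    (hgrow.eventually_gt_atTop (Real.log C₂ + d * (Real.log R - Real.log θ) + |c| * S -
      Real.log (moranMass q v k₀))))).exists
  have h4 := le_log_moranLength_sub ha hab v 0 (N + m)
  rw [zero_add] at h4
  simp only [moranLength, Real.log_one] at h4
  push_cast at h4
  have h5 : (m : ℝ) * -Real.log b ≤ -Real.log (moranLength a b v (N + m)) := by
    have : 0 ≤ (N : ℝ) * -Real.log b := by positivity
    linarith
  have h6 := mul_le_mul_of_nonneg_left h5 (show 0 ≤ (D - d) / 2 by linarith)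
  linarith

theorem upperPhiDim_moranMeasure (ha : 0 < a) (hab : a < b) (hsum : a + b < 1)
    {q : ℕ → I} (hq : ∀ i, (q i : ℝ) ∈ Set.Ioo 0 1)
    (hwin : HasSmallWindowSums fun i => (q i : ℝ) - 1 / 2) {D c : ℝ} (hD0 : 0 ≤ D)
    (hle : ∀ i (l : Bool), -Real.log (if l then 1 - (q i : ℝ) else q i) ≤
      D * -Real.log (if l then b else a) + c * ((q i : ℝ) - 1 / 2))
    (heq : ∀ i, ∃ l : Bool, -Real.log (if l then 1 - (q i : ℝ) else q i) =
      D * -Real.log (if l then b else a) + c * ((q i : ℝ) - 1 / 2))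
    {Φ : ℝ → ℝ} (hΦ : IsDimensionFunction Φ) (hΦl : IsLargeDimensionFunction Φ) :
    upperPhiDim Φ (moranMeasure a b q) = (D : EReal) := by
  refine le_antisymm ?_ (le_sInf ?_)
  · refine EReal.le_of_forall_lt_iff_le.1 fun d hd => ?_
    have hDd : D < d := EReal.coe_lt_coe_iff.1 hd
    exact sInf_le ⟨d, isUpperPhiExponent_moranMeasure ha hab hsum hq hwin hle hDd
      (hD0.trans hDd.le) hΦl, rfl⟩
  · rintro _ ⟨d, hd, rfl⟩
    exact EReal.coe_le_coe_iff.2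
      (le_of_isUpperPhiExponent_moranMeasure ha hab hsum hq hwin heq hΦ hd)

end Dimension

/-! ### Choice of the exponent and the multiplier -/

theorem mainTheorem11 {Ω : Type*} [MeasurableSpace Ω] (P : Measure Ω) [IsProbabilityMeasure P]
    (a b : ℝ) (ha : 0 < a) (hab : a < b) (hsum : a + b < 1)
    (p : unitInterval) (hp_pos : 0 < (p : ℝ)) (hp_lt : (p : ℝ) < 1 / 2)
    (X : ℕ → Ω → unitInterval) (hX_meas : ∀ n, Measurable (X n))
    (hX_indep : iIndepFun X P)
    (hX_law : ∀ n, P.map (X n) = uniformOn {p, unitInterval.symm p})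
    (β η : ℝ) (hβ : a ^ β = b) (hη : (1 - (p : ℝ)) ^ η = p) :
    ∀ᵐ ω ∂P, ∀ Φ : ℝ → ℝ, IsDimensionFunction Φ → IsLargeDimensionFunction Φ →
      upperPhiDim Φ (moranMeasure a b fun n => X n ω) =
        ((if 0 ≤ η + 1 + β - 3 * η * β then
            (Real.log p + Real.log (1 - p)) / (2 * Real.log b)
          else
            Real.log p / ((1 / 2) * (Real.log a + Real.log b)) : ℝ) : EReal) := by
  have hwin : ∀ᵐ ω ∂P, HasSmallWindowSums fun n => (X n ω : ℝ) - 1 / 2 :=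
    ae_hasSmallWindowSums
      (hX_indep.comp (fun _ t => (t : ℝ) - 1 / 2) fun _ => measurable_subtype_coe.sub_const _)
      fun n => hasSubgaussianMGF_of_map_eq_uniformOn_pair hp_lt (hX_meas n) (hX_law n)
  have hmem : ∀ᵐ ω ∂P, ∀ n, X n ω ∈ ({p, σ p} : Set I) :=
    ae_all_iff.2 fun n => ae_mem_of_map_eq_uniformOn (hX_meas n)
      (Set.toFinite _).measurableSet (hX_law n)
  filter_upwards [hwin, hmem] with ω hω hval Φ hΦ hΦl
  have hb := ha.trans hab
  have hlog_p : Real.log p < Real.log (1 - p) := Real.log_lt_log hp_pos (by linarith)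
  have hlog_q : Real.log (1 - p) < 0 := Real.log_neg (by linarith) (by linarith)
  have hlog_b : Real.log b < 0 := Real.log_neg hb (by linarith)
  have hlog_a : Real.log a < Real.log b := Real.log_lt_log ha hab
  have hβ' : Real.log b = β * Real.log a := by rw [← hβ, Real.log_rpow ha]
  have hη' : Real.log p = η * Real.log (1 - p) := by
    conv_lhs => rw [← hη]
    exact Real.log_rpow (by linarith) η
  -- the sign condition compares the two candidates
  set D₁ := (Real.log p + Real.log (1 - p)) / (2 * Real.log b) with hD₁
  set D₂ := Real.log p / ((1 / 2) * (Real.log a + Real.log b)) with hD₂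
  have e1 : D₁ * (2 * Real.log b) = Real.log p + Real.log (1 - p) :=
    div_mul_cancel₀ _ (by linarith)
  have e2 : D₂ * (Real.log a + Real.log b) = 2 * Real.log p := by
    rw [hD₂]; field_simp [show Real.log a + Real.log b ≠ 0 by linarith]
  have hsign : (η + 1 + β - 3 * η * β) * (Real.log (1 - p) * Real.log a) =
      (D₁ - D₂) * (2 * Real.log b * (Real.log a + Real.log b)) := by
    have : (D₁ - D₂) * (2 * Real.log b * (Real.log a + Real.log b)) =
        (Real.log p + Real.log (1 - p)) * (Real.log a + Real.log b) -
          2 * Real.log p * (2 * Real.log b) := by rw [← e1, ← e2]; ring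
    rw [this, hη', hβ']
    ring
  have hpos1 : 0 < Real.log (1 - p) * Real.log a := mul_pos_of_neg_of_neg hlog_q (by linarith)
  have hpos2 : 0 < 2 * Real.log b * (Real.log a + Real.log b) :=
    mul_pos_of_neg_of_neg (by linarith) (by linarith)
  have hmax : (if 0 ≤ η + 1 + β - 3 * η * β then D₁ else D₂) = max D₁ D₂ := by
    split_ifs with h
    · refine (max_eq_left (sub_nonneg.1 (nonneg_of_mul_nonneg_left ?_ hpos2))).symm
      rw [← hsign]
      exact mul_nonneg h hpos1.le
    · refine (max_eq_right (sub_nonpos.1 (not_lt.1 fun h' => h ?_))).symm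
      refine (nonneg_of_mul_nonneg_left ?_ hpos1)
      rw [hsign]
      exact (mul_pos h' hpos2).le
  rw [hmax]
  set D := max D₁ D₂ with hD
  have hD₁0 : 0 < D₁ := div_pos_of_neg_of_neg (by linarith) (by linarith)
  have hD0 : 0 < D := lt_max_of_lt_left hD₁0
  have f1 : -(Real.log p + Real.log (1 - p)) ≤ D * (2 * -Real.log b) := by
    have := mul_le_mul_of_nonneg_right (le_max_left D₁ D₂) (show 0 ≤ 2 * -Real.log b by linarith)
    linarith
  have f2 : -(2 * Real.log p) ≤ D * -(Real.log a + Real.log b) := by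
    have := mul_le_mul_of_nonneg_right (le_max_right D₁ D₂)
      (show 0 ≤ -(Real.log a + Real.log b) by linarith)
    linarith
  have f3 : D * -Real.log b ≤ D * -Real.log a := by gcongr
  -- This `c` is dictated by equality for the right child when `q = 1 - p`. Then `f1` and `f2` are
  -- the inequalities for the right and left child when `q = p`, and `f3` with `hlog_p` gives the
  -- left child when `q = 1 - p`.
  set c := (-Real.log p - D * -Real.log b) / (1 / 2 - p) with hc
  have hcp : c * (1 / 2 - p) = -Real.log p - D * -Real.log b :=
    div_mul_cancel₀ _ (by linarith)
  have hcases : ∀ n, (X n ω : ℝ) = p ∨ (X n ω : ℝ) = 1 - p := fun n => by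
    rcases hval n with h | h
    · exact Or.inl (by rw [h])
    · exact Or.inr (by rw [h]; rfl)
  refine upperPhiDim_moranMeasure ha hab hsum (fun n => ?_) hω hD0.le (c := c) (fun n l => ?_)
    (fun n => ?_) hΦ hΦl
  · rcases hcases n with h | h <;> rw [h] <;> constructor <;> linarith
  · rcases hcases n with h | h <;> rw [h] <;> cases l <;> simp <;> linarith
  · rcases hcases n with h | h <;> rw [h]
    -- For `q = p` the tight constraint is the one whose candidate attains the maximum: right child
    -- for `D₁`, left child for `D₂`.
    · rcases max_choice D₁ D₂ with hD' | hD'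
      · refine ⟨true, ?_⟩
        rw [← hD] at hD'
        rw [← hD'] at e1
        simp
        linarith
      · refine ⟨false, ?_⟩
        rw [← hD] at hD'
        rw [← hD'] at e2
        simp
        linarith
    · refine ⟨true, ?_⟩
      simp
      linarith
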